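/- Let $R$ be an associative ring with unit. A left $R$-module $M$ is called $\mathcal F_1$-flat if $\mathrm{Tor}_1^R(H,M)=0$ for every right $R$-module $H$ of flat dimension at most one. Then the following statements are equivalent: 1. every $\mathcal F_1$-flat left $R$-module is projective; 2. $R$ is left perfect (every left $R$-module has a projective cover) and left hereditary (every left ideal of $R$ is projective); 3. $R$ is left perfect and its weak global dimension (the supremum of the flat dimensions of the right $R$-modules) satisfies $\mathrm{wdim}(R)\le 1$. -/

import Mathlib

open CategoryTheory TensorProduct

universe u

noncomputable section

namespace RingHomological

/-! Conventions: `R` is an associative unital ring, not assumed commutative. Left `R`-modules are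
`Module R M`; right `R`-modules are `Module Rᵐᵒᵖ H`, with `h · r = MulOpposite.op r • h`. -/

section Tensor

variable (R : Type u) [Ring R]

/-- The subgroup of `H ⊗[ℤ] M` generated by the elements `(h · r) ⊗ m - h ⊗ (r • m)`. -/
def balancedRel (H : Type u) [AddCommGroup H] [Module Rᵐᵒᵖ H]
    (M : Type u) [AddCommGroup M] [Module R M] : AddSubgroup (H ⊗[ℤ] M) :=
  AddSubgroup.closure {x | ∃ (h : H) (r : R) (m : M),
    x = (MulOpposite.op r • h) ⊗ₜ[ℤ] m - h ⊗ₜ[ℤ] (r • m)}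

/-- The tensor product `H ⊗_R M` of a right `R`-module and a left `R`-module (an abelian group). -/
abbrev BalancedTensor (H : Type u) [AddCommGroup H] [Module Rᵐᵒᵖ H]
    (M : Type u) [AddCommGroup M] [Module R M] : Type u :=
  (H ⊗[ℤ] M) ⧸ balancedRel R H M

/-- The pure tensor `h ⊗ m` in `H ⊗_R M`. -/
def btmul {H : Type u} [AddCommGroup H] [Module Rᵐᵒᵖ H]
    {M : Type u} [AddCommGroup M] [Module R M] (h : H) (m : M) : BalancedTensor R H M :=
  QuotientAddGroup.mk (h ⊗ₜ[ℤ] m)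

/-- The map `id_H ⊗ f : H ⊗_R M → H ⊗_R N` induced by an `R`-linear map `f : M → N`. -/
def balancedLTensor (H : Type u) [AddCommGroup H] [Module Rᵐᵒᵖ H]
    {M N : Type u} [AddCommGroup M] [Module R M] [AddCommGroup N] [Module R N]
    (f : M →ₗ[R] N) : BalancedTensor R H M →+ BalancedTensor R H N :=
  QuotientAddGroup.map _ _
    (LinearMap.lTensor H f.toAddMonoidHom.toIntLinearMap).toAddMonoidHom <| by
      refine (AddSubgroup.closure_le _).2 ?_
      rintro _ ⟨h, r, m, rfl⟩
      refine AddSubgroup.subset_closure ⟨h, r, f m, ?_⟩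
      rw [map_sub, ← f.map_smul]
      rfl

theorem balancedLTensor_btmul (H : Type u) [AddCommGroup H] [Module Rᵐᵒᵖ H]
    {M N : Type u} [AddCommGroup M] [Module R M] [AddCommGroup N] [Module R N]
    (f : M →ₗ[R] N) (h : H) (m : M) :
    balancedLTensor R H f (btmul R h m) = btmul R h (f m) := rfl

theorem balancedTensor_hom_ext (H : Type u) [AddCommGroup H] [Module Rᵐᵒᵖ H]
    {M : Type u} [AddCommGroup M] [Module R M] {A : Type u} [AddCommGroup A]
    {f g : BalancedTensor R H M →+ A}
    (w : ∀ (h : H) (m : M), f (btmul R h m) = g (btmul R h m)) : f = g := by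
  refine QuotientAddGroup.addMonoidHom_ext _ (AddMonoidHom.ext fun x => ?_)
  induction x using TensorProduct.induction_on with
  | zero => rw [map_zero, map_zero]
  | tmul h m => exact w h m
  | add a b ha hb => rw [map_add, map_add, ha, hb]

/-- The functor `H ⊗_R -` from left `R`-modules to abelian groups. -/
def tensorFunctor (H : Type u) [AddCommGroup H] [Module Rᵐᵒᵖ H] :
    ModuleCat.{u} R ⥤ AddCommGrpCat.{u} where
  obj M := AddCommGrpCat.of (BalancedTensor R H M)
  map f := AddCommGrpCat.ofHom (balancedLTensor R H f.hom)
  map_id M := by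
    refine AddCommGrpCat.hom_ext (balancedTensor_hom_ext R H fun h m => ?_)
    rfl
  map_comp f g := by
    refine AddCommGrpCat.hom_ext (balancedTensor_hom_ext R H fun h m => ?_)
    rfl

instance tensorFunctor_additive (H : Type u) [AddCommGroup H] [Module Rᵐᵒᵖ H] :
    (tensorFunctor R H).Additive where
  map_add {M N f g} := by
    refine AddCommGrpCat.hom_ext (balancedTensor_hom_ext R H fun h m => ?_)
    exact congrArg (QuotientAddGroup.mk (s := balancedRel R H N))
      (TensorProduct.tmul_add h (f.hom m) (g.hom m))

/-- `Tor_n^R(H, M)`: the `n`-th left derived functor of `H ⊗_R -` evaluated at `M`. -/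
def tor (n : ℕ) (H : Type u) [AddCommGroup H] [Module Rᵐᵒᵖ H]
    (M : Type u) [AddCommGroup M] [Module R M] : AddCommGrpCat.{u} :=
  ((tensorFunctor R H).leftDerived n).obj (ModuleCat.of R M)

end Tensor

section Dimension

variable (R : Type u) [Ring R]

/-- A right `R`-module `H` is flat if `H ⊗_R -` preserves injectivity. -/
def IsFlatRight (H : Type u) [AddCommGroup H] [Module Rᵐᵒᵖ H] : Prop :=
  ∀ (M N : Type u) [AddCommGroup M] [AddCommGroup N] [Module R M] [Module R N] (f : M →ₗ[R] N),
    Function.Injective f → Function.Injective (balancedLTensor R H f)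

/-- The right `R`-module `H` has a flat resolution `0 → F_n → ⋯ → F_0 → H → 0`; such a resolution
is built up from its first map `F_0 → H` and a flat resolution of length `n - 1` of the kernel. -/
def HasFlatResolution : ℕ → ∀ (H : Type u) [AddCommGroup H] [Module Rᵐᵒᵖ H], Prop
  | 0, H, _, _ => IsFlatRight R H
  | n + 1, H, _, _ => ∃ (F : ModuleCat.{u} Rᵐᵒᵖ) (p : F →ₗ[Rᵐᵒᵖ] H),
      IsFlatRight R F ∧ Function.Surjective p ∧ HasFlatResolution n (LinearMap.ker p)

/-- The flat dimension `fd_R(H)` of a right `R`-module: the least length of a flat resolution,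
and `∞` if there is no finite one. -/
def flatDim (H : Type u) [AddCommGroup H] [Module Rᵐᵒᵖ H] : ℕ∞ :=
  ⨅ (n : ℕ) (_ : HasFlatResolution R n H), (n : ℕ∞)

/-- The weak global dimension of `R`: the supremum of the flat dimensions of the right
`R`-modules. -/
def wdim : ℕ∞ :=
  ⨆ H : ModuleCat.{u} Rᵐᵒᵖ, flatDim R H

/-- A left `R`-module `M` is `ℱ₁`-flat if `Tor_1^R(H, M) = 0` for every right `R`-module `H` of
flat dimension at most one. -/
def IsF1Flat (M : Type u) [AddCommGroup M] [Module R M] : Prop :=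
  ∀ H : ModuleCat.{u} Rᵐᵒᵖ, flatDim R H ≤ 1 → Limits.IsZero (tor R 1 H M)

end Dimension

section RingClasses

variable (R : Type u) [Ring R]

/-- A submodule `K` of `P` is superfluous if `N + K = P` implies `N = P` for all submodules `N`. -/
def IsSuperfluous {P : Type u} [AddCommGroup P] [Module R P] (K : Submodule R P) : Prop :=
  ∀ N : Submodule R P, N ⊔ K = ⊤ → N = ⊤

/-- `M` has a projective cover: a surjection from a projective module with superfluous kernel. -/
def HasProjectiveCover (M : Type u) [AddCommGroup M] [Module R M] : Prop :=
  ∃ (P : ModuleCat.{u} R) (p : P →ₗ[R] M),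
    Module.Projective R P ∧ Function.Surjective p ∧ IsSuperfluous R (LinearMap.ker p)

/-- `R` is left perfect if every left `R`-module has a projective cover. -/
def IsLeftPerfect : Prop :=
  ∀ (M : Type u) [AddCommGroup M] [Module R M], HasProjectiveCover R M

/-- `R` is left hereditary if every left ideal of `R` is projective. (`Ideal R` is the type of left
ideals.) -/
def IsLeftHereditary : Prop :=
  ∀ I : Ideal R, Module.Projective R I

end RingClasses

end RingHomological

end

/-! Let `N` be a submodule of a projective `P`, and let `0 → K → F → H → 0` have `K` and `F` flat.
Then `K ⊗ N → K ⊗ P → F ⊗ P` is injective and factors through `F ⊗ N`, so Tor_1(H, N) = 0 and `N` is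
ℱ₁-flat. Moreover Tor_1 commutes with directed unions of kernels. So if ℱ₁-flat modules are
projective, the projective left modules are closed under submodules (`SubmodulesProjective`) and
under directed unions of kernels (`UnionsProjective`). The first property makes `R` hereditary.

Together the two properties make `R` perfect, by an Enochs-style construction of covers. Zorn's
lemma gives a surjection `q : Q → M` from a projective module that factors through no proper
projective quotient (`IsTight`). A second use of Zorn, with a cardinality bound, shows that every
endomorphism of `Q` over `M` is surjective, and this forces `ker q` to be superfluous.

Conversely, if `R` is hereditary then submodules of flat right modules are flat, so the weak
dimension is at most one. In that case ℱ₁-flat means flat, and the projective cover of a flat module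
has a kernel that is both pure and superfluous, hence zero (`injective_of_superfluous_of_pure`). -/

noncomputable section

namespace RingHomological

/-! ### Exactness and flatness for the balanced tensor product -/

section TensorLemmas

variable {R : Type u} [Ring R]
variable {H H' H'' : Type u} [AddCommGroup H] [Module Rᵐᵒᵖ H] [AddCommGroup H'] [Module Rᵐᵒᵖ H']
  [AddCommGroup H''] [Module Rᵐᵒᵖ H'']
variable {M N P : Type u} [AddCommGroup M] [Module R M] [AddCommGroup N] [Module R N]
  [AddCommGroup P] [Module R P]

theorem btmul_add (h : H) (m m' : M) : btmul R h (m + m') = btmul R h m + btmul R h m' :=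
  congrArg (QuotientAddGroup.mk (s := balancedRel R H M)) (tmul_add h m m')

theorem add_btmul (h h' : H) (m : M) : btmul R (h + h') m = btmul R h m + btmul R h' m :=
  congrArg (QuotientAddGroup.mk (s := balancedRel R H M)) (add_tmul h h' m)

theorem btmul_zero (h : H) : btmul R h (0 : M) = 0 :=
  congrArg (QuotientAddGroup.mk (s := balancedRel R H M)) (tmul_zero M h)

theorem zero_btmul (m : M) : btmul R (0 : H) m = 0 :=
  congrArg (QuotientAddGroup.mk (s := balancedRel R H M)) (zero_tmul H m)

theorem op_smul_btmul (h : H) (r : R) (m : M) :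
    btmul R (MulOpposite.op r • h) m = btmul R h (r • m) := by
  rw [← sub_eq_zero]
  exact (QuotientAddGroup.eq_zero_iff _).2 (AddSubgroup.subset_closure ⟨h, r, m, rfl⟩)

/-- The map `m ↦ h ⊗ m`. -/
def btmulRight (h : H) : M →+ BalancedTensor R H M where
  toFun := btmul R h
  map_zero' := btmul_zero h
  map_add' := btmul_add h

/-- The map `h ↦ h ⊗ m`. -/
def btmulLeft (m : M) : H →+ BalancedTensor R H M where
  toFun h := btmul R h m
  map_zero' := zero_btmul m
  map_add' h h' := add_btmul h h' m

/-- The universal property of `H ⊗_R M`. -/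
def balancedLift {A : Type u} [AddCommGroup A] (f : H →+ M →+ A)
    (hf : ∀ h (r : R) m, f (MulOpposite.op r • h) m = f h (r • m)) : BalancedTensor R H M →+ A :=
  QuotientAddGroup.lift _ (TensorProduct.liftAddHom f fun n h m => by simp) <| by
    refine (AddSubgroup.closure_le _).2 ?_
    rintro _ ⟨h, r, m, rfl⟩
    change _ = _
    rw [map_sub, liftAddHom_tmul, liftAddHom_tmul, hf, sub_self]

variable (M) in
/-- The map `g ⊗ id_M : H ⊗_R M → H' ⊗_R M` induced by an `R`-linear map `g : H → H'`. -/
def balancedRTensor (g : H →ₗ[Rᵐᵒᵖ] H') : BalancedTensor R H M →+ BalancedTensor R H' M :=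
  QuotientAddGroup.map _ _
    (LinearMap.rTensor M g.toAddMonoidHom.toIntLinearMap).toAddMonoidHom <| by
      refine (AddSubgroup.closure_le _).2 ?_
      rintro _ ⟨h, r, m, rfl⟩
      refine AddSubgroup.subset_closure ⟨g h, r, m, ?_⟩
      rw [map_sub, ← g.map_smul]
      rfl

theorem balancedLTensor_comp (g : N →ₗ[R] P) (f : M →ₗ[R] N) (x : BalancedTensor R H M) :
    balancedLTensor R H g (balancedLTensor R H f x) = balancedLTensor R H (g ∘ₗ f) x :=
  DFunLike.congr_fun (f := (balancedLTensor R H g).comp (balancedLTensor R H f))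
    (g := balancedLTensor R H (g ∘ₗ f)) (balancedTensor_hom_ext R H fun _ _ => rfl) x

theorem balancedLTensor_id (x : BalancedTensor R H M) :
    balancedLTensor R H (LinearMap.id : M →ₗ[R] M) x = x :=
  DFunLike.congr_fun (f := balancedLTensor R H LinearMap.id) (g := AddMonoidHom.id _)
    (balancedTensor_hom_ext R H fun _ _ => rfl) x

theorem balancedLTensor_zero (x : BalancedTensor R H M) :
    balancedLTensor R H (0 : M →ₗ[R] N) x = 0 :=
  DFunLike.congr_fun (g := 0) (balancedTensor_hom_ext R H fun h _ => btmul_zero h) x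

theorem balancedLTensor_add (f g : M →ₗ[R] N) (x : BalancedTensor R H M) :
    balancedLTensor R H (f + g) x = balancedLTensor R H f x + balancedLTensor R H g x :=
  DFunLike.congr_fun (g := balancedLTensor R H f + balancedLTensor R H g)
    (balancedTensor_hom_ext R H fun h m => btmul_add h (f m) (g m)) x

theorem balancedRTensor_comp (g : H' →ₗ[Rᵐᵒᵖ] H'') (f : H →ₗ[Rᵐᵒᵖ] H')
    (x : BalancedTensor R H M) :
    balancedRTensor M g (balancedRTensor M f x) = balancedRTensor M (g ∘ₗ f) x :=
  DFunLike.congr_fun (f := (balancedRTensor M g).comp (balancedRTensor M f))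
    (g := balancedRTensor M (g ∘ₗ f)) (balancedTensor_hom_ext R H fun _ _ => rfl) x

theorem balancedRTensor_balancedLTensor (g : H →ₗ[Rᵐᵒᵖ] H') (f : M →ₗ[R] N)
    (x : BalancedTensor R H M) :
    balancedRTensor N g (balancedLTensor R H f x) =
      balancedLTensor R H' f (balancedRTensor M g x) :=
  DFunLike.congr_fun (f := (balancedRTensor N g).comp (balancedLTensor R H f))
    (g := (balancedLTensor R H' f).comp (balancedRTensor M g))
    (balancedTensor_hom_ext R H fun _ _ => rfl) x

theorem balancedLTensor_surjective (H : Type u) [AddCommGroup H] [Module Rᵐᵒᵖ H]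
    {f : M →ₗ[R] N} (hf : Function.Surjective f) :
    Function.Surjective (balancedLTensor R H f) := by
  intro y
  obtain ⟨y, rfl⟩ := QuotientAddGroup.mk_surjective y
  obtain ⟨x, rfl⟩ := LinearMap.lTensor_surjective H
    (g := f.toAddMonoidHom.toIntLinearMap) hf y
  exact ⟨QuotientAddGroup.mk x, rfl⟩

theorem balancedRTensor_surjective (M : Type u) [AddCommGroup M] [Module R M]
    {g : H →ₗ[Rᵐᵒᵖ] H'} (hg : Function.Surjective g) :
    Function.Surjective (balancedRTensor M g) := by
  intro y
  obtain ⟨y, rfl⟩ := QuotientAddGroup.mk_surjective y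
  obtain ⟨x, rfl⟩ := LinearMap.rTensor_surjective M
    (g := g.toAddMonoidHom.toIntLinearMap) hg y
  exact ⟨QuotientAddGroup.mk x, rfl⟩

/-- Right exactness of `H ⊗_R -`. -/
theorem balancedLTensor_exact (H : Type u) [AddCommGroup H] [Module Rᵐᵒᵖ H]
    {f : M →ₗ[R] N} {g : N →ₗ[R] P} (hfg : Function.Exact f g) (hg : Function.Surjective g) :
    Function.Exact (balancedLTensor R H f) (balancedLTensor R H g) := by
  intro y
  constructor
  · obtain ⟨y, rfl⟩ := QuotientAddGroup.mk_surjective y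
    intro hy
    let g' := (LinearMap.lTensor H g.toAddMonoidHom.toIntLinearMap).toAddMonoidHom
    have hy' : g' y ∈ balancedRel R H P := (QuotientAddGroup.eq_zero_iff _).1 hy
    have hle : balancedRel R H P ≤ (balancedRel R H N).map g' := by
      refine (AddSubgroup.closure_le _).2 ?_
      rintro _ ⟨h, r, p, rfl⟩
      obtain ⟨n, rfl⟩ := hg p
      refine ⟨_, AddSubgroup.subset_closure ⟨h, r, n, rfl⟩, ?_⟩
      rw [map_sub, ← g.map_smul]
      rfl
    obtain ⟨z, hz, hzy⟩ := hle hy'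
    have h0 : g' (y - z) = 0 := by rw [map_sub, hzy, sub_self]
    obtain ⟨x, hx⟩ := (lTensor_exact H (f := f.toAddMonoidHom.toIntLinearMap)
      (g := g.toAddMonoidHom.toIntLinearMap) hfg hg (y - z)).1 h0
    refine ⟨QuotientAddGroup.mk x, ?_⟩
    change QuotientAddGroup.mk (LinearMap.lTensor H f.toAddMonoidHom.toIntLinearMap x) = _
    rw [hx, QuotientAddGroup.mk_sub, (QuotientAddGroup.eq_zero_iff z).2 hz, sub_zero]
  · rintro ⟨x, rfl⟩
    rw [balancedLTensor_comp, hfg.linearMap_comp_eq_zero, balancedLTensor_zero]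

/-- Right exactness of `- ⊗_R M`. -/
theorem balancedRTensor_exact (M : Type u) [AddCommGroup M] [Module R M]
    {f : H →ₗ[Rᵐᵒᵖ] H'} {g : H' →ₗ[Rᵐᵒᵖ] H''} (hfg : Function.Exact f g)
    (hg : Function.Surjective g) (y : BalancedTensor R H' M) (hy : balancedRTensor M g y = 0) :
    ∃ x, balancedRTensor M f x = y := by
  obtain ⟨y, rfl⟩ := QuotientAddGroup.mk_surjective y
  let g' := (LinearMap.rTensor M g.toAddMonoidHom.toIntLinearMap).toAddMonoidHom
  have hy' : g' y ∈ balancedRel R H'' M := (QuotientAddGroup.eq_zero_iff _).1 hy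
  have hle : balancedRel R H'' M ≤ (balancedRel R H' M).map g' := by
    refine (AddSubgroup.closure_le _).2 ?_
    rintro _ ⟨h, r, m, rfl⟩
    obtain ⟨h, rfl⟩ := hg h
    refine ⟨_, AddSubgroup.subset_closure ⟨h, r, m, rfl⟩, ?_⟩
    rw [map_sub, ← g.map_smul]
    rfl
  obtain ⟨z, hz, hzy⟩ := hle hy'
  have h0 : g' (y - z) = 0 := by rw [map_sub, hzy, sub_self]
  obtain ⟨x, hx⟩ := (rTensor_exact M (f := f.toAddMonoidHom.toIntLinearMap)
    (g := g.toAddMonoidHom.toIntLinearMap) hfg hg (y - z)).1 h0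
  refine ⟨QuotientAddGroup.mk x, ?_⟩
  change QuotientAddGroup.mk (LinearMap.rTensor M f.toAddMonoidHom.toIntLinearMap x) = _
  rw [hx, QuotientAddGroup.mk_sub, (QuotientAddGroup.eq_zero_iff z).2 hz, sub_zero]

/-- Projective left modules are flat. -/
theorem balancedRTensor_injective_of_projective (P : Type u) [AddCommGroup P] [Module R P]
    [Module.Projective R P] {g : H →ₗ[Rᵐᵒᵖ] H'} (hg : Function.Injective g) :
    Function.Injective (balancedRTensor P g) := by
  obtain ⟨s, hs⟩ := Module.projective_def'.1 (inferInstance : Module.Projective R P)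
  -- Compare `H ⊗ R^(P)` with `H^(P)`. Only the left inverse identity is needed, since it already
  -- makes `toFun` injective.
  let toFun (H : Type u) [AddCommGroup H] [Module Rᵐᵒᵖ H] :
      BalancedTensor R H (P →₀ R) →+ (P →₀ H) :=
    balancedLift
      { toFun h := Finsupp.mapRange.addMonoidHom
          { toFun r := MulOpposite.op r • h
            map_zero' := by simp
            map_add' r r' := by simp [add_smul] }
        map_zero' := by ext; simp
        map_add' h h' := by ext; simp }
      fun h r m => by ext i; simp [mul_smul]
  let invFun (H : Type u) [AddCommGroup H] [Module Rᵐᵒᵖ H] :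
      (P →₀ H) →+ BalancedTensor R H (P →₀ R) :=
    Finsupp.liftAddHom fun i => btmulLeft (Finsupp.single i 1)
  have hinv (H : Type u) [AddCommGroup H] [Module Rᵐᵒᵖ H] (x) : invFun H (toFun H x) = x := by
    refine DFunLike.congr_fun (f := (invFun H).comp (toFun H)) (g := AddMonoidHom.id _)
      (balancedTensor_hom_ext R H fun h m => ?_) x
    change invFun H (toFun H (btmulRight h m)) = btmulRight h m
    induction m using Finsupp.induction_linear with
    | zero => simp only [map_zero]
    | add a b ha hb => simp only [map_add, ha, hb]
    | single i r =>
      change invFun H (Finsupp.mapRange _ (map_zero _) (Finsupp.single i r)) = btmul R h _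
      rw [Finsupp.mapRange_single]
      change Finsupp.liftAddHom _ (Finsupp.single i (MulOpposite.op r • h)) = _
      rw [Finsupp.liftAddHom_apply_single]
      change btmul R _ _ = _
      rw [op_smul_btmul, Finsupp.smul_single, smul_eq_mul, mul_one]
  have hnat (x : BalancedTensor R H (P →₀ R)) : toFun H' (balancedRTensor _ g x) =
      Finsupp.mapRange.addMonoidHom g.toAddMonoidHom (toFun H x) := by
    refine DFunLike.congr_fun (f := (toFun H').comp (balancedRTensor _ g))
      (g := (Finsupp.mapRange.addMonoidHom g.toAddMonoidHom).comp (toFun H))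
      (balancedTensor_hom_ext R H fun h m => ?_) x
    ext i
    exact (g.map_smul (MulOpposite.op (m i)) h).symm
  refine (injective_iff_map_eq_zero _).2 fun x hx => ?_
  -- `P` is a retract of a free module through `s`, so vanishing can be tested after applying `s`.
  rw [← balancedLTensor_id x, ← hs, ← balancedLTensor_comp]
  suffices h0 : balancedLTensor R H s x = 0 by rw [h0, map_zero]
  have h1 : toFun H (balancedLTensor R H s x) = 0 := by
    refine Finsupp.mapRange_injective g g.map_zero hg ?_
    refine (hnat _).symm.trans ?_
    rw [balancedRTensor_balancedLTensor, hx, map_zero, map_zero, Finsupp.mapRange_zero]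
  rw [← hinv H (balancedLTensor R H s x), h1, map_zero]

/-- Free right modules are flat. -/
theorem isFlatRight_finsupp (ι : Type u) : IsFlatRight R (ι →₀ Rᵐᵒᵖ) := by
  intro M N _ _ _ _ f hf
  let toFun (M : Type u) [AddCommGroup M] [Module R M] :
      BalancedTensor R (ι →₀ Rᵐᵒᵖ) M →+ (ι →₀ M) :=
    balancedLift
      (AddMonoidHom.flip
        { toFun m := Finsupp.mapRange.addMonoidHom
            { toFun r := MulOpposite.unop r • m
              map_zero' := by simp
              map_add' r r' := by simp [add_smul] }
          map_zero' := by ext; simp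
          map_add' h h' := by ext; simp })
      fun h r m => by ext i; simp [mul_smul]
  let invFun (M : Type u) [AddCommGroup M] [Module R M] :
      (ι →₀ M) →+ BalancedTensor R (ι →₀ Rᵐᵒᵖ) M :=
    Finsupp.liftAddHom fun i => btmulRight (Finsupp.single i 1)
  have hinv (M : Type u) [AddCommGroup M] [Module R M] (x) : invFun M (toFun M x) = x := by
    refine DFunLike.congr_fun (f := (invFun M).comp (toFun M)) (g := AddMonoidHom.id _)
      (balancedTensor_hom_ext R _ fun h m => ?_) x
    change invFun M (toFun M (btmulLeft m h)) = btmulLeft m h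
    induction h using Finsupp.induction_linear with
    | zero => simp only [map_zero]
    | add a b ha hb => simp only [map_add, ha, hb]
    | single i r =>
      change invFun M (Finsupp.mapRange _ (map_zero _) (Finsupp.single i r)) = btmul R _ m
      rw [Finsupp.mapRange_single]
      change Finsupp.liftAddHom _ (Finsupp.single i (MulOpposite.unop r • m)) = _
      rw [Finsupp.liftAddHom_apply_single]
      change btmul R _ _ = _
      rw [← op_smul_btmul, Finsupp.smul_single, smul_eq_mul, mul_one, MulOpposite.op_unop]
  have hnat (x : BalancedTensor R (ι →₀ Rᵐᵒᵖ) M) : toFun N (balancedLTensor R _ f x) =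
      Finsupp.mapRange.addMonoidHom f.toAddMonoidHom (toFun M x) := by
    refine DFunLike.congr_fun (f := (toFun N).comp (balancedLTensor R _ f))
      (g := (Finsupp.mapRange.addMonoidHom f.toAddMonoidHom).comp (toFun M))
      (balancedTensor_hom_ext R _ fun h m => ?_) x
    ext i
    exact (f.map_smul (MulOpposite.unop (h i)) m).symm
  refine (injective_iff_map_eq_zero _).2 fun x hx => ?_
  have h1 : toFun M x = 0 := by
    refine Finsupp.mapRange_injective f f.map_zero hf ?_
    refine (hnat _).symm.trans ?_
    rw [hx, map_zero, Finsupp.mapRange_zero]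
  rw [← hinv M x, h1, map_zero]

end TensorLemmas

/-! ### Vanishing of Tor_1 and ℱ₁-flat modules -/

section TorLemmas

variable {R : Type u} [Ring R]
variable {H : Type u} [AddCommGroup H] [Module Rᵐᵒᵖ H]
variable {M P Q : Type u} [AddCommGroup M] [Module R M] [AddCommGroup P] [Module R P]
  [AddCommGroup Q] [Module R Q]

/-- Injectivity of `H ⊗ ker p → H ⊗ P` does not depend on the presentation `p : P → M`. -/
theorem balancedLTensor_ker_injective_of_presentation [Module.Projective R P]
    [Module.Projective R Q] {p : P →ₗ[R] M} (hp : Function.Surjective p)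
    {q : Q →ₗ[R] M} (hq : Function.Surjective q)
    (hinj : Function.Injective (balancedLTensor R H (LinearMap.ker q).subtype)) :
    Function.Injective (balancedLTensor R H (LinearMap.ker p).subtype) := by
  obtain ⟨a, ha⟩ := Module.projective_lifting_property q p hq
  obtain ⟨b, hb⟩ := Module.projective_lifting_property p q hp
  have hqa (x : P) : q (a x) = p x := DFunLike.congr_fun ha x
  have hpb (x : Q) : p (b x) = q x := DFunLike.congr_fun hb x
  let a' : LinearMap.ker p →ₗ[R] LinearMap.ker q :=
    a.restrict fun x hx => by simpa [hqa] using hx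
  let b' : LinearMap.ker q →ₗ[R] LinearMap.ker p :=
    b.restrict fun x hx => by simpa [hpb] using hx
  -- The chain homotopy: `1 - ba` lands in `ker p`, so on `H ⊗ ker p` the identity is `b'a'` plus a
  -- map that factors through `H ⊗ P`.
  let e : P →ₗ[R] LinearMap.ker p :=
    (LinearMap.id - b ∘ₗ a).codRestrict _ fun x => by simp [hqa, hpb]
  refine (injective_iff_map_eq_zero _).2 fun x hx => ?_
  have ha0 : balancedLTensor R H a' x = 0 := by
    refine hinj ?_
    have : (LinearMap.ker q).subtype ∘ₗ a' = a ∘ₗ (LinearMap.ker p).subtype := rfl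
    rw [balancedLTensor_comp, this, ← balancedLTensor_comp, hx, map_zero, map_zero]
  have hid : (LinearMap.id : LinearMap.ker p →ₗ[R] _) =
      b' ∘ₗ a' + e ∘ₗ (LinearMap.ker p).subtype := by
    ext x
    simp [a', b', e]
  rw [← balancedLTensor_id x, hid, balancedLTensor_add, ← balancedLTensor_comp,
    ← balancedLTensor_comp, ha0, hx, map_zero, map_zero, add_zero]

/-- If `P₂ → P₁ → P₀ → M → 0` is exact, then `H ⊗ P₂ → H ⊗ P₁ → H ⊗ P₀` is exact if and only if
`H ⊗ K → H ⊗ P₀` is injective, where `K` is the kernel of `P₀ → M`. -/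
theorem balancedLTensor_exact_iff_injective {P₀ P₁ P₂ : Type u} [AddCommGroup P₀] [Module R P₀]
    [AddCommGroup P₁] [Module R P₁] [AddCommGroup P₂] [Module R P₂]
    {d₂ : P₂ →ₗ[R] P₁} {d₁ : P₁ →ₗ[R] P₀} {p : P₀ →ₗ[R] M}
    (h₂ : Function.Exact d₂ d₁) (h₁ : Function.Exact d₁ p) :
    Function.Exact (balancedLTensor R H d₂) (balancedLTensor R H d₁) ↔
      Function.Injective (balancedLTensor R H (LinearMap.ker p).subtype) := by
  -- `d₁` is the surjection `c`, with cokernel presentation `P₂ → P₁ → ker p`, followed by the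
  -- inclusion. Right exactness leaves only the inclusion to test.
  let c : P₁ →ₗ[R] LinearMap.ker p := d₁.codRestrict _ fun x => (h₁ _).2 ⟨x, rfl⟩
  have hc : Function.Surjective c := fun y => by
    obtain ⟨x, hx⟩ := (h₁ y).1 y.2
    exact ⟨x, Subtype.ext hx⟩
  have hcd (x) : balancedLTensor R H d₁ x =
      balancedLTensor R H (LinearMap.ker p).subtype (balancedLTensor R H c x) := by
    rw [balancedLTensor_comp]; rfl
  have hex : Function.Exact d₂ c := fun x => by
    rw [← h₂ x, ← Subtype.coe_inj]; rfl
  have hex' := balancedLTensor_exact H hex hc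
  constructor
  · refine fun h => (injective_iff_map_eq_zero _).2 fun x hx => ?_
    obtain ⟨y, rfl⟩ := balancedLTensor_surjective H hc x
    rw [← hcd] at hx
    exact (hex' y).2 ((h y).1 hx)
  · intro h x
    rw [← hex' x, hcd]
    exact map_eq_zero_iff _ h

/-- `Tor_1^R(H, M) = 0` if and only if `H ⊗ K → H ⊗ P` is injective for a presentation `P → M`
with kernel `K`. -/
theorem isZero_tor_one_iff [Module.Projective R P] {p : P →ₗ[R] M} (hp : Function.Surjective p) :
    Limits.IsZero (tor R 1 H M) ↔
      Function.Injective (balancedLTensor R H (LinearMap.ker p).subtype) := by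
  let X := projectiveResolution (ModuleCat.of R M)
  let C := ((tensorFunctor R H).mapHomologicalComplex (ComplexShape.down ℕ)).obj X.complex
  have hπ : Function.Surjective (X.π.f 0).hom :=
    (ModuleCat.epi_iff_surjective _).1 inferInstance
  have hproj : Module.Projective R (X.complex.X 0) :=
    (IsProjective.iff_projective _).2 (X.projective 0)
  have h₂ : Function.Exact (X.complex.d 2 1).hom (X.complex.d 1 0).hom :=
    (ShortComplex.ShortExact.moduleCat_exact_iff_function_exact _).1 (X.exact_succ 0)
  have h₁ : Function.Exact (X.complex.d 1 0).hom (X.π.f 0).hom :=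
    (ShortComplex.ShortExact.moduleCat_exact_iff_function_exact _).1 X.exact₀
  have hiso := (X.isoLeftDerivedObj (tensorFunctor R H) 1).isZero_iff
  refine hiso.trans ((C.exactAt_iff_isZero_homology 1).symm.trans ?_)
  rw [C.exactAt_iff' 2 1 0 (by simp) (by simp), ShortComplex.ab_exact_iff_function_exact]
  refine (balancedLTensor_exact_iff_injective (H := H) h₂ h₁).trans ?_
  exact ⟨balancedLTensor_ker_injective_of_presentation (M := M) hp hπ,
    balancedLTensor_ker_injective_of_presentation (M := M) hπ hp⟩

/-- A module has flat dimension at most one if and only if it is flat or has a flat resolution of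
length one. -/
theorem flatDim_le_one_iff : flatDim R H ≤ 1 ↔ IsFlatRight R H ∨ HasFlatResolution R 1 H := by
  constructor
  · intro h
    by_contra! hn
    have : (2 : ℕ∞) ≤ flatDim R H := by
      refine le_iInf₂ fun n hres => ?_
      match n, hres with
      | 0, hres => exact absurd hres hn.1
      | 1, hres => exact absurd hres hn.2
      | n + 2, _ => exact_mod_cast Nat.le_add_left 2 n
    exact absurd (this.trans h) (by decide)
  · rintro (h | h)
    · exact (iInf₂_le (f := fun (n : ℕ) (_ : HasFlatResolution R n H) => (n : ℕ∞)) 0 h).trans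
        (by simp)
    · exact iInf₂_le (f := fun (n : ℕ) (_ : HasFlatResolution R n H) => (n : ℕ∞)) 1 h

theorem isFlatRight_of_subsingleton [Subsingleton H] : IsFlatRight R H := by
  intro M N _ _ _ _ f _
  have h0 (x : BalancedTensor R H M) : x = 0 :=
    DFunLike.congr_fun (f := AddMonoidHom.id _) (g := 0) (balancedTensor_hom_ext R H fun h m => by
      rw [Subsingleton.elim h 0]; exact zero_btmul m) x
  exact fun x y _ => (h0 x).trans (h0 y).symm

theorem hasFlatResolution_one_of_isFlatRight (h : IsFlatRight R H) : HasFlatResolution R 1 H := by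
  refine ⟨ModuleCat.of Rᵐᵒᵖ H, LinearMap.id, h, Function.surjective_id, ?_⟩
  have : Subsingleton (LinearMap.ker (LinearMap.id : H →ₗ[Rᵐᵒᵖ] H)) := by
    rw [LinearMap.ker_id]; infer_instance
  exact isFlatRight_of_subsingleton

/-- Submodules of projective modules are `ℱ₁`-flat. -/
theorem isF1Flat_of_injective {N : Type u} [AddCommGroup N] [Module R N] [Module.Projective R P]
    {i : N →ₗ[R] P} (hi : Function.Injective i) : IsF1Flat R N := by
  intro H hH
  obtain ⟨F, g, hF, hg, hK⟩ : HasFlatResolution R 1 H :=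
    (flatDim_le_one_iff.1 hH).elim hasFlatResolution_one_of_isFlatRight id
  let q : (N →₀ R) →ₗ[R] N := Finsupp.linearCombination R id
  have hq : Function.Surjective q := Finsupp.linearCombination_id_surjective R N
  let k := (LinearMap.ker q).subtype
  let g' := (LinearMap.ker g).subtype
  have hgg : Function.Exact g' g := LinearMap.exact_subtype_ker_map g
  have hkq : Function.Exact k q := LinearMap.exact_subtype_ker_map q
  have hex (A : Type u) [AddCommGroup A] [Module Rᵐᵒᵖ A] :
      Function.Exact (balancedLTensor R A k) (balancedLTensor R A q) :=
    balancedLTensor_exact (M := LinearMap.ker q) (N := N →₀ R) A hkq hq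
  have hN : Function.Injective (balancedRTensor N g') := by
    have h1 : Function.Injective (balancedLTensor R F i ∘ balancedRTensor N g') := by
      have : balancedLTensor R F i ∘ balancedRTensor N g' =
          balancedRTensor P g' ∘ balancedLTensor R _ i :=
        funext fun x => (balancedRTensor_balancedLTensor g' i x).symm
      rw [this]
      exact (balancedRTensor_injective_of_projective P (Submodule.injective_subtype _)).comp
        (hK _ _ i hi)
    exact h1.of_comp
  -- Diagram chase in the tensor product of `ker g → F → H` with `ker q → R^(N) → N`. It uses that
  -- `hN` makes the column over `N` injective and that flatness of `F` makes its row injective.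
  refine (isZero_tor_one_iff hq).2 ((injective_iff_map_eq_zero _).2 fun x hx => ?_)
  obtain ⟨y, rfl⟩ := balancedRTensor_surjective _ hg x
  rw [← balancedRTensor_balancedLTensor] at hx
  obtain ⟨w, hw⟩ := balancedRTensor_exact _ hgg hg _ hx
  have hw0 : balancedLTensor R _ q w = 0 := by
    refine hN ?_
    rw [balancedRTensor_balancedLTensor, hw, map_zero]
    exact (hex F).apply_apply_eq_zero y
  obtain ⟨v, rfl⟩ := (hex (LinearMap.ker g) w).1 hw0
  have hv : balancedRTensor _ g' v = y := by
    refine hF _ _ k (Submodule.injective_subtype _) ?_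
    rw [← balancedRTensor_balancedLTensor, hw]
  rw [← hv, balancedRTensor_comp, hgg.linearMap_comp_eq_zero]
  exact DFunLike.congr_fun (f := balancedRTensor _ (0 : LinearMap.ker g →ₗ[Rᵐᵒᵖ] H)) (g := 0)
    (balancedTensor_hom_ext R _ fun _ m => zero_btmul m) v

/-- Unions of chains of submodules with `ℱ₁`-flat quotients have `ℱ₁`-flat quotients. -/
theorem isF1Flat_quotient_sSup [Module.Projective R P] {c : Set (Submodule R P)}
    (hne : c.Nonempty) (hc : DirectedOn (· ≤ ·) c) (hflat : ∀ L ∈ c, IsF1Flat R (P ⧸ L)) :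
    IsF1Flat R (P ⧸ sSup c) := by
  intro H hH
  refine (isZero_tor_one_iff (Submodule.mkQ_surjective _)).2
    ((injective_iff_map_eq_zero _).2 fun x hx => ?_)
  have hker (L : Submodule R P) (hL : IsF1Flat R (P ⧸ L)) :
      Function.Injective (balancedLTensor R H L.subtype) := by
    have := (isZero_tor_one_iff (Submodule.mkQ_surjective L)).1 (hL H hH)
    rwa [Submodule.ker_mkQ] at this
  generalize hK : LinearMap.ker (sSup c).mkQ = K at x hx
  rw [Submodule.ker_mkQ] at hK
  have hle (L) (hL : L ∈ c) : L ≤ K := hK ▸ le_sSup hL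
  -- A tensor involves finitely many elements of the union, so it already comes from a single member
  -- `L`, where injectivity into `H ⊗ P` is known.
  have key : ∃ L, ∃ hL : L ∈ c, ∃ y, balancedLTensor R H (Submodule.inclusion (hle L hL)) y = x := by
    obtain ⟨x, rfl⟩ := QuotientAddGroup.mk_surjective x
    clear hx
    induction x using TensorProduct.induction_on with
    | zero =>
      obtain ⟨L, hL⟩ := hne
      exact ⟨L, hL, 0, map_zero _⟩
    | tmul h m =>
      obtain ⟨L, hL, hm⟩ := (Submodule.mem_sSup_of_directed hne hc).1 (hK ▸ m.2 : (m : P) ∈ sSup c)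
      exact ⟨L, hL, btmul R h ⟨m, hm⟩, rfl⟩
    | add a b ha hb =>
      obtain ⟨L, hL, y, hy⟩ := ha
      obtain ⟨L', hL', y', hy'⟩ := hb
      obtain ⟨L'', hL'', h1, h2⟩ := hc L hL L' hL'
      refine ⟨L'', hL'', balancedLTensor R H (Submodule.inclusion h1) y +
        balancedLTensor R H (Submodule.inclusion h2) y', ?_⟩
      rw [map_add, balancedLTensor_comp, balancedLTensor_comp]
      exact congrArg₂ (· + ·) hy hy'
  obtain ⟨L, hL, y, rfl⟩ := key
  rw [balancedLTensor_comp] at hx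
  rw [hker L (hflat L hL) (a₁ := y) (a₂ := 0) (by rw [map_zero]; exact hx), map_zero]

end TorLemmas

/-! ### Pure kernels, and projectivity of flat modules over perfect rings -/

section PureSubmodules

variable {R : Type u} [Ring R]
variable {M P : Type u} [AddCommGroup M] [Module R M] [AddCommGroup P] [Module R P]

/-- Villamayor's lemma: elements of a pure submodule `K` of a projective module `P` are fixed by
some homomorphism `P → K`. -/
theorem exists_map_fixing_of_pure [Module.Projective R P] {K : Submodule R P}
    (hK : ∀ H : ModuleCat.{u} Rᵐᵒᵖ, Function.Injective (balancedLTensor R H K.subtype))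
    (k : K) : ∃ f : P →ₗ[R] K, f k = k := by
  obtain ⟨s, hs⟩ := Module.projective_def'.1 (inferInstance : Module.Projective R P)
  let c := s k
  have hc : ∑ p ∈ c.support, c p • p = (k : P) := DFunLike.congr_fun hs (k : P)
  -- Test purity against `R ⧸ I`, with `I` the right ideal generated by the coordinates of `k`.
  -- There `1 ⊗ k` dies over `P`, hence over `K`, which says `k ∈ IK`. Writing `k = ∑ c p • g p`
  -- with `g p ∈ K` then gives the map.
  let I : Submodule Rᵐᵒᵖ R := Submodule.span Rᵐᵒᵖ (Set.range c)
  let w : (P → K) →+ K :=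
    { toFun g := ∑ p ∈ c.support, c p • g p
      map_zero' := by simp
      map_add' g g' := by simp [Finset.sum_add_distrib] }
  have hw (r : R) (hr : r ∈ I) : ∀ x : K, r • x ∈ w.range := by
    induction hr using Submodule.span_induction with
    | mem r hr =>
      obtain ⟨p, rfl⟩ := hr
      intro x
      by_cases hp : p ∈ c.support
      · refine ⟨fun p' => by classical exact if p' = p then x else 0, ?_⟩
        exact (Finset.sum_eq_single_of_mem p hp fun p' _ h => by simp [h]).trans (by simp)
      · rw [Finsupp.notMem_support_iff.1 hp, zero_smul]
        exact zero_mem _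
    | zero => exact fun x => by rw [zero_smul]; exact zero_mem _
    | add a b _ _ ha hb => exact fun x => by rw [add_smul]; exact add_mem (ha x) (hb x)
    | smul t r _ hr =>
      intro x
      rw [MulOpposite.smul_eq_mul_unop, mul_smul]
      exact hr _
  let φ : R →+ (K →+ K ⧸ w.range) :=
    { toFun r := (QuotientAddGroup.mk' w.range).comp (DistribSMul.toAddMonoidHom K r)
      map_zero' := by ext x; simp
      map_add' r r' := by ext x; simp [add_smul] }
  let φ' : R ⧸ I →+ (K →+ K ⧸ w.range) := QuotientAddGroup.lift I.toAddSubgroup φ fun r hr =>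
    AddMonoidHom.ext fun x => (QuotientAddGroup.eq_zero_iff _).2 (hw r hr x)
  let ψ : BalancedTensor R (R ⧸ I) K →+ K ⧸ w.range := balancedLift φ' fun h r x => by
    obtain ⟨h, rfl⟩ := Submodule.Quotient.mk_surjective I h
    change φ (MulOpposite.op r • h) x = φ h (r • x)
    simp [φ, mul_smul]
  have h0 : btmul R (Submodule.Quotient.mk (1 : R) : R ⧸ I) k = 0 := by
    refine hK (ModuleCat.of Rᵐᵒᵖ (R ⧸ I)) ?_
    rw [map_zero, balancedLTensor_btmul]
    change btmulRight (Submodule.Quotient.mk (1 : R) : R ⧸ I) (k : P) = 0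
    rw [← hc, map_sum]
    refine Finset.sum_eq_zero fun p _ => ?_
    change btmul R _ (c p • p) = 0
    rw [← op_smul_btmul, ← Submodule.Quotient.mk_smul, MulOpposite.smul_eq_mul_unop,
      MulOpposite.unop_op, one_mul,
      (Submodule.Quotient.mk_eq_zero I).2 (Submodule.subset_span ⟨p, rfl⟩), zero_btmul]
  have h1 : k ∈ w.range := by
    have h2 : φ 1 k = 0 := (congrArg ψ h0).trans (map_zero ψ)
    simpa [φ] using h2
  obtain ⟨g, hg⟩ := h1
  exact ⟨Finsupp.linearCombination R g ∘ₗ s, hg⟩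

/-- A projective cover with pure kernel is injective. -/
theorem injective_of_superfluous_of_pure [Module.Projective R P] {p : P →ₗ[R] M}
    (hp : IsSuperfluous R (LinearMap.ker p))
    (hpure : ∀ H : ModuleCat.{u} Rᵐᵒᵖ,
      Function.Injective (balancedLTensor R H (LinearMap.ker p).subtype)) :
    Function.Injective p := by
  refine (injective_iff_map_eq_zero _).2 fun k hk => ?_
  obtain ⟨f, hf⟩ := exists_map_fixing_of_pure hpure ⟨k, hk⟩
  -- `g = 1 - f` is the identity modulo `ker p`, so superfluity makes it onto. The same applies to
  -- its section `σ`. Hence `g` is bijective, yet it kills `k`.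
  let g : P →ₗ[R] P := LinearMap.id - (LinearMap.ker p).subtype ∘ₗ f
  have hg (x : P) : g x = x - f x := rfl
  have hgs : Function.Surjective g := by
    refine LinearMap.range_eq_top.1 (hp _ (eq_top_iff.2 fun x _ => ?_))
    refine Submodule.mem_sup.2 ⟨g x, ⟨x, rfl⟩, f x, (f x).2, ?_⟩
    rw [hg, sub_add_cancel]
  obtain ⟨σ, hσ⟩ := Module.projective_lifting_property g LinearMap.id hgs
  have hσ (x : P) : g (σ x) = x := DFunLike.congr_fun hσ x
  have hσs : Function.Surjective σ := by
    refine LinearMap.range_eq_top.1 (hp _ (eq_top_iff.2 fun x _ => ?_))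
    refine Submodule.mem_sup.2 ⟨σ x, ⟨x, rfl⟩, -f (σ x), neg_mem (f (σ x)).2, ?_⟩
    rw [← sub_eq_add_neg, ← hg, hσ]
  obtain ⟨y, rfl⟩ := hσs k
  have : y = 0 := by rw [← hσ y, hg, hf, sub_self]
  rw [this, map_zero]

/-- Over a left perfect ring of weak dimension at most one, `ℱ₁`-flat modules are projective. -/
theorem projective_of_isF1Flat (hR : IsLeftPerfect R) (hw : wdim R ≤ 1) (hM : IsF1Flat R M) :
    Module.Projective R M := by
  obtain ⟨P, p, hP, hp, hs⟩ := hR M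
  have hinj : Function.Injective p := injective_of_superfluous_of_pure hs fun H =>
    (isZero_tor_one_iff hp).1
      (hM H ((le_iSup (fun H : ModuleCat.{u} Rᵐᵒᵖ => flatDim R H) H).trans hw))
  exact Module.Projective.of_equiv (LinearEquiv.ofBijective p ⟨hinj, hp⟩)

end PureSubmodules

theorem exists_projective_surjection (R : Type u) [Ring R] (M : Type u) [AddCommGroup M]
    [Module R M] : ∃ (P : ModuleCat.{u} R) (p : P →ₗ[R] M),
      Module.Projective R P ∧ Function.Surjective p :=
  ⟨ModuleCat.of R (M →₀ R), Finsupp.linearCombination R id,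
    inferInstanceAs (Module.Projective R (M →₀ R)), Finsupp.linearCombination_id_surjective R M⟩

/-! ### Hereditary rings: projective submodules and weak dimension -/

section Hereditary

variable {R : Type u} [Ring R]
variable {N P : Type u} [AddCommGroup N] [Module R N] [AddCommGroup P] [Module R P]

/-- Over a left hereditary ring, quotients of injective modules are injective. -/
theorem IsLeftHereditary.injective_quotient (hR : IsLeftHereditary R) {E : Type u}
    [AddCommGroup E] [Module R E] [Module.Injective R E] (A : Submodule R E) :
    Module.Injective R (E ⧸ A) := by
  refine Module.Baer.injective fun I g => ?_
  have := hR I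
  obtain ⟨t, ht⟩ := Module.projective_lifting_property A.mkQ g A.mkQ_surjective
  obtain ⟨T, hT⟩ := Module.Injective.extension_property R E I R I.subtype I.injective_subtype t
  refine ⟨A.mkQ ∘ₗ T, fun x hx => ?_⟩
  rw [← ht, ← hT]
  rfl

/-- Over a left hereditary ring, submodules of projective modules are projective. -/
theorem IsLeftHereditary.projective_of_injective (hR : IsLeftHereditary R)
    [Module.Projective R P] (i : N →ₗ[R] P) (hi : Function.Injective i) :
    Module.Projective R N := by
  refine Module.Projective.of_lifting_property'' fun f hf => ?_
  obtain ⟨E, hE, ι, hι⟩ : ∃ E : ModuleCat.{u} R, Module.Injective R E ∧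
      ∃ ι : (N →₀ R) →ₗ[R] E, Function.Injective ι := by
    obtain ⟨⟨E, hE, ι, hι⟩⟩ := EnoughInjectives.presentation (ModuleCat.of R (N →₀ R))
    exact ⟨E, Module.injective_module_of_injective_object R E, ι.hom,
      (ModuleCat.mono_iff_injective ι).1 hι⟩
  -- To split `f`, map `N` into the injective module `E ⧸ A`, extend over `P`, and lift to `E` by
  -- projectivity of `P`. Modulo `A` the lift agrees with `ι` on preimages under `f`, so on `N` it
  -- lands in the image of `ι`.
  let A := (LinearMap.ker f).map ι
  have := hR.injective_quotient A
  let t : N →ₗ[R] E ⧸ A := (LinearMap.ker f).mapQ A ι (Submodule.le_comap_map _ _) ∘ₗ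
    (f.quotKerEquivOfSurjective hf).symm.toLinearMap
  have ht (x : N →₀ R) : t (f x) = A.mkQ (ι x) := by
    have : (f.quotKerEquivOfSurjective hf).symm (f x) = (LinearMap.ker f).mkQ x := by
      rw [LinearEquiv.symm_apply_eq]; rfl
    simp only [t, LinearMap.comp_apply, LinearEquiv.coe_coe, this]
    rfl
  obtain ⟨T, hT⟩ := Module.Injective.extension_property R (E ⧸ A) N P i hi t
  obtain ⟨S, hS⟩ := Module.projective_lifting_property A.mkQ T A.mkQ_surjective
  have hSi (x : N →₀ R) : S (i (f x)) - ι x ∈ A := by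
    rw [← Submodule.ker_mkQ A, LinearMap.mem_ker, map_sub, ← ht, ← hT, ← hS, sub_eq_zero]
    rfl
  have hrange (n : N) : S (i n) ∈ LinearMap.range ι := by
    obtain ⟨x, rfl⟩ := hf n
    obtain ⟨y, _, hy⟩ := hSi x
    exact ⟨y + x, by rw [map_add, hy, sub_add_cancel]⟩
  let h : N →ₗ[R] (N →₀ R) := (LinearEquiv.ofInjective ι hι).symm.toLinearMap ∘ₗ
    (S ∘ₗ i).codRestrict _ hrange
  have hh (n : N) : ι (h n) = S (i n) :=
    congrArg Subtype.val ((LinearEquiv.ofInjective ι hι).apply_symm_apply ⟨S (i n), hrange n⟩)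
  refine ⟨h, LinearMap.ext fun n => ?_⟩
  obtain ⟨x, rfl⟩ := hf n
  obtain ⟨y, hy, hyx⟩ := hSi x
  rw [← hh, ← map_sub] at hyx
  have h0 := hι hyx
  rw [h0] at hy
  have h1 : f (h (f x) - x) = 0 := hy
  rwa [map_sub, sub_eq_zero] at h1

/-- If submodules of projective left modules are projective, then submodules of flat right modules
are flat. -/
theorem isFlatRight_of_injective
    (hsub : ∀ (N P : Type u) [AddCommGroup N] [Module R N] [AddCommGroup P] [Module R P]
      [Module.Projective R P] (i : N →ₗ[R] P), Function.Injective i → Module.Projective R N)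
    {F K : Type u} [AddCommGroup F] [Module Rᵐᵒᵖ F] [AddCommGroup K] [Module Rᵐᵒᵖ K]
    (hF : IsFlatRight R F) (g : K →ₗ[Rᵐᵒᵖ] F) (hg : Function.Injective g) : IsFlatRight R K := by
  intro M N _ _ _ _ f hf
  obtain ⟨P, q, _, hq⟩ := exists_projective_surjection R N
  -- Pull `f` back along `q`. The projective `A` covers `M` with the same kernel `ker q`, and `K ⊗ A
  -- → F ⊗ A → F ⊗ P` is injective, so `K ⊗ A → K ⊗ P` is too.
  let A := (LinearMap.range f).comap q
  have hA : Module.Projective R A := hsub A P A.subtype A.injective_subtype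
  let κ : A →ₗ[R] M := (LinearEquiv.ofInjective f hf).symm.toLinearMap ∘ₗ
    q.restrict (p := A) (q := LinearMap.range f) fun x hx => hx
  have hκ (x : A) : f (κ x) = q x :=
    congrArg Subtype.val ((LinearEquiv.ofInjective f hf).apply_symm_apply ⟨q x, x.2⟩)
  have hκs : Function.Surjective κ := fun m => by
    obtain ⟨x, hx⟩ := hq (f m)
    exact ⟨⟨x, m, hx.symm⟩, hf ((hκ _).trans hx)⟩
  let l : LinearMap.ker q →ₗ[R] A := Submodule.inclusion fun x hx => ⟨0, by
    rw [map_zero]; exact (LinearMap.mem_ker.1 hx).symm⟩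
  have hinj : Function.Injective (balancedLTensor R K A.subtype) := by
    have h1 : Function.Injective (balancedRTensor _ g ∘ balancedLTensor R K A.subtype) := by
      have : balancedRTensor _ g ∘ balancedLTensor R K A.subtype =
          balancedLTensor R F A.subtype ∘ balancedRTensor A g :=
        funext fun x => balancedRTensor_balancedLTensor g A.subtype x
      rw [this]
      exact (hF _ _ _ A.injective_subtype).comp (balancedRTensor_injective_of_projective A hg)
    exact h1.of_comp
  have hex : Function.Exact (balancedLTensor R K (LinearMap.ker q).subtype)
      (balancedLTensor R K q) :=
    balancedLTensor_exact K
      (LinearMap.exact_subtype_ker_map q) hq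
  refine (injective_iff_map_eq_zero _).2 fun x hx => ?_
  obtain ⟨y, rfl⟩ := balancedLTensor_surjective K hκs x
  have hfκ : f ∘ₗ κ = q ∘ₗ A.subtype := LinearMap.ext hκ
  rw [balancedLTensor_comp, hfκ, ← balancedLTensor_comp] at hx
  obtain ⟨z, hz⟩ := (hex _).1 hx
  have hzy : balancedLTensor R K l z = y := by
    refine hinj ?_
    rw [balancedLTensor_comp, ← hz]
    rfl
  have hκl : κ ∘ₗ l = 0 := LinearMap.ext fun v => hf ((hκ _).trans (by
    rw [LinearMap.zero_apply, map_zero]; exact v.2))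
  rw [← hzy, balancedLTensor_comp, hκl, balancedLTensor_zero]

/-- A left hereditary ring has weak dimension at most one. -/
theorem IsLeftHereditary.wdim_le_one (hR : IsLeftHereditary R) : wdim R ≤ 1 := by
  refine iSup_le fun H => flatDim_le_one_iff.2 (Or.inr ?_)
  refine ⟨ModuleCat.of Rᵐᵒᵖ (H →₀ Rᵐᵒᵖ), Finsupp.linearCombination Rᵐᵒᵖ id,
    isFlatRight_finsupp _, Finsupp.linearCombination_id_surjective Rᵐᵒᵖ H, ?_⟩
  refine isFlatRight_of_injective (fun N P _ _ _ _ _ i hi => hR.projective_of_injective i hi)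
    (isFlatRight_finsupp H) (Submodule.subtype _) (Submodule.injective_subtype _)

end Hereditary

/-! ### Projective covers from closure under submodules and unions -/

section ProjectiveCovers

variable {R : Type u} [Ring R]
variable {M Q : Type u} [AddCommGroup M] [Module R M] [AddCommGroup Q] [Module R Q]

variable (R) in
/-- Submodules of projective left modules are projective. -/
def SubmodulesProjective : Prop :=
  ∀ (N P : Type u) [AddCommGroup N] [Module R N] [AddCommGroup P] [Module R P]
    [Module.Projective R P] (i : N →ₗ[R] P), Function.Injective i → Module.Projective R N

variable (R) in
/-- Directed unions of submodules with projective quotients in projective left modules have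
projective quotients. -/
def UnionsProjective : Prop :=
  ∀ (P : Type u) [AddCommGroup P] [Module R P] [Module.Projective R P] (c : Set (Submodule R P)),
    c.Nonempty → DirectedOn (· ≤ ·) c → (∀ L ∈ c, Module.Projective R (P ⧸ L)) →
      Module.Projective R (P ⧸ sSup c)

/-- A map `q : Q → M` from a projective module is tight if every map from `Q` to a projective
module whose kernel lies in `ker q` is injective. -/
def IsTight (q : Q →ₗ[R] M) : Prop :=
  Module.Projective R Q ∧ ∀ (P : Type u) [AddCommGroup P] [Module R P] [Module.Projective R P]
    (h : Q →ₗ[R] P), LinearMap.ker h ≤ LinearMap.ker q → Function.Injective h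

theorem SubmodulesProjective.projective_quotient (hsub : SubmodulesProjective R)
    {P : Type u} [AddCommGroup P] [Module R P] [Module.Projective R P] (h : Q →ₗ[R] P)
    {L : Submodule R Q} (hL : LinearMap.ker h = L) : Module.Projective R (Q ⧸ L) := by
  subst hL
  exact hsub _ P _ (LinearMap.ker_eq_bot.1 (Submodule.ker_liftQ_eq_bot' _ h rfl))

/-- Divide a projective presentation by a maximal submodule of its kernel with projective quotient.
A map to a projective module violating tightness would give a larger such submodule, its image being
projective. -/
theorem exists_isTight_surjective (hsub : SubmodulesProjective R) (hunion : UnionsProjective R)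
    (M : Type u) [AddCommGroup M] [Module R M] :
    ∃ (Q : ModuleCat.{u} R) (q : Q →ₗ[R] M), IsTight q ∧ Function.Surjective q := by
  obtain ⟨P, p, _, hp⟩ := exists_projective_surjection R M
  obtain ⟨L, -, ⟨hLp, hL⟩, hmax⟩ := zorn_le_nonempty₀
    {L : Submodule R P | L ≤ LinearMap.ker p ∧ Module.Projective R (P ⧸ L)}
    (fun c hc hchain L hL => ⟨sSup c, ⟨sSup_le fun L hL => (hc hL).1,
      hunion P c ⟨L, hL⟩ hchain.directedOn fun L hL => (hc hL).2⟩, fun _ => le_sSup⟩)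
    ⊥ ⟨bot_le, hsub.projective_quotient LinearMap.id LinearMap.ker_id⟩
  refine ⟨ModuleCat.of R (P ⧸ L), L.liftQ p hLp, ⟨hL, fun N _ _ _ h hh => ?_⟩, ?_⟩
  · refine (injective_iff_map_eq_zero _).2 fun x hx => ?_
    obtain ⟨x, rfl⟩ := L.mkQ_surjective x
    refine (Submodule.Quotient.mk_eq_zero L).2 (hmax (y := LinearMap.ker (h ∘ₗ L.mkQ))
      ⟨fun y hy => hh (x := L.mkQ y) hy, hsub.projective_quotient (h ∘ₗ L.mkQ) rfl⟩
      (fun y hy => ?_) hx)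
    have : L.mkQ y = 0 := (Submodule.Quotient.mk_eq_zero L).2 hy
    rw [LinearMap.mem_ker, LinearMap.comp_apply, this, map_zero]
  · exact fun m => (hp m).imp' L.mkQ fun _ h => h

/-- The submodules `L` of a free module on `X` over `M` for which the module generated by a set
`S ⊆ X` modulo `L` is tight over `M` and contains `S`. -/
structure IsTightPair {X : Type u} (φ : (X →₀ R) →ₗ[R] M) (S : Set X)
    (L : Submodule R (X →₀ R)) : Prop where
  le_supported : L ≤ Finsupp.supported R R S
  le_ker : L ≤ LinearMap.ker φ
  projective : Module.Projective R ((X →₀ R) ⧸ L)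
  eq_of_sub_mem : ∀ s ∈ S, ∀ t ∈ S, Finsupp.single s (1 : R) - Finsupp.single t 1 ∈ L → s = t
  tight : ∀ (P : Type u) [AddCommGroup P] [Module R P] [Module.Projective R P]
    (h : (X →₀ R) →ₗ[R] P), L ≤ LinearMap.ker h →
      LinearMap.ker h ⊓ Finsupp.supported R R S ≤ LinearMap.ker φ →
      LinearMap.ker h ⊓ Finsupp.supported R R S ≤ L

theorem isTightPair_empty (hsub : SubmodulesProjective R) {X : Type u}
    (φ : (X →₀ R) →ₗ[R] M) : IsTightPair φ ∅ ⊥ where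
  le_supported := bot_le
  le_ker := bot_le
  projective := hsub.projective_quotient LinearMap.id LinearMap.ker_id
  eq_of_sub_mem := fun _ hs => hs.elim
  tight P _ _ _ h _ _ := by rw [Finsupp.supported_empty]; exact inf_le_right

/-- Apart from projectivity, which is `hunion`, each condition is either a containment or concerns
finitely many basis elements, hence is inherited from one member of the chain. -/
theorem isTightPair_sSup (hunion : UnionsProjective R) {X : Type u} {φ : (X →₀ R) →ₗ[R] M}
    {c : Set (Set X × Submodule R (X →₀ R))} (hne : c.Nonempty) (hc : IsChain (· ≤ ·) c)
    (h : ∀ a ∈ c, IsTightPair φ a.1 a.2) :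
    IsTightPair φ (⋃ a ∈ c, a.1) (sSup (Prod.snd '' c)) := by
  have hdir : DirectedOn (· ≤ ·) c := hc.directedOn
  have hdir₂ : DirectedOn (· ≤ ·) (Prod.snd '' c) := by
    rintro _ ⟨a, ha, rfl⟩ _ ⟨b, hb, rfl⟩
    obtain ⟨d, hd, had, hbd⟩ := hdir a ha b hb
    exact ⟨d.2, ⟨d, hd, rfl⟩, had.2, hbd.2⟩
  refine ⟨sSup_le ?_, sSup_le ?_, ?_, ?_, ?_⟩
  · rintro _ ⟨a, ha, rfl⟩
    exact (h a ha).le_supported.trans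
      (Finsupp.supported_mono (Set.subset_biUnion_of_mem (u := Prod.fst) ha))
  · rintro _ ⟨a, ha, rfl⟩
    exact (h a ha).le_ker
  · refine hunion _ _ (hne.image _) hdir₂ ?_
    rintro _ ⟨a, ha, rfl⟩
    exact (h a ha).projective
  · intro s hs t ht hst
    obtain ⟨a, ha, hs⟩ := Set.mem_iUnion₂.1 hs
    obtain ⟨b, hb, ht⟩ := Set.mem_iUnion₂.1 ht
    obtain ⟨_, ⟨d, hd, rfl⟩, hst⟩ := (Submodule.mem_sSup_of_directed (hne.image _) hdir₂).1 hst
    obtain ⟨e, he, hae, hbe⟩ := hdir a ha b hb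
    obtain ⟨e', he', hee, hde⟩ := hdir e he d hd
    exact (h e' he').eq_of_sub_mem s (hee.1 (hae.1 hs)) t (hee.1 (hbe.1 ht)) (hde.2 hst)
  · rintro P _ _ _ g hg hgφ x ⟨hx, hxS⟩
    obtain ⟨a₀, ha₀⟩ := hne
    obtain ⟨a, ha, hxa⟩ := DirectedOn.exists_mem_subset_of_finset_subset_biUnion (f := Prod.fst)
      ⟨a₀, ha₀⟩ (hdir.mono' fun _ _ _ _ hab => hab.1) ((Finsupp.mem_supported R x).1 hxS)
    have hle : a.2 ≤ sSup (Prod.snd '' c) := le_sSup ⟨a, ha, rfl⟩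
    refine hle ((h a ha).tight P g (hle.trans hg) (le_trans ?_ hgφ) ⟨hx, hxa⟩)
    exact inf_le_inf_left _ (Finsupp.supported_mono (Set.subset_biUnion_of_mem (u := Prod.fst) ha))

/-- A tight pair `(S, L)` embedded properly into a tight module `Q` can be enlarged. -/
theorem IsTightPair.exists_lt (hsub : SubmodulesProjective R) {q : Q →ₗ[R] M} (hq : IsTight q)
    {φ : (Set Q × Q →₀ R) →ₗ[R] M} (hφ : ∀ x, φ (Finsupp.single x 1) = q x.2)
    {S : Set (Set Q × Q)} {L : Submodule R (Set Q × Q →₀ R)} (hSL : IsTightPair φ S L)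
    (g : (Set Q × Q →₀ R) →ₗ[R] Q) (hg : q ∘ₗ g = φ) (hLg : L ≤ LinearMap.ker g)
    {y₀ : Q} (hy₀ : y₀ ∉ (Finsupp.supported R R S).map g) :
    ∃ S' L', IsTightPair φ S' L' ∧ S ⊂ S' ∧ L ≤ L' := by
  classical
  have := hq.1
  have hker : LinearMap.ker g ⊓ Finsupp.supported R R S ≤ L :=
    hSL.tight Q g hLg (inf_le_left.trans (hg ▸ LinearMap.ker_le_ker_comp g q))
  have hsingle {s} {A : Set (Set Q × Q)} (hs : s ∈ A) :
      Finsupp.single s (1 : R) ∈ Finsupp.supported R R A :=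
    Finsupp.single_mem_supported R 1 hs
  have hinj {s t} (hs : s ∈ S) (ht : t ∈ S)
      (hst : g (Finsupp.single s 1) = g (Finsupp.single t 1)) : s = t :=
    hSL.eq_of_sub_mem s hs t ht (hker ⟨LinearMap.mem_ker.2 (by rw [map_sub, hst, sub_self]),
      sub_mem (hsingle hs) (hsingle ht)⟩)
  -- The basis is indexed by `Set Q × Q` for this step: `S` injects into `Q`, so by Cantor its
  -- labels cannot exhaust `Set Q`.
  obtain ⟨k, hk⟩ : ∃ k : Set Q, ∀ s ∈ S, s.1 ≠ k := by
    by_contra! hcon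
    choose s hsS hs using hcon
    refine Function.cantor_injective (fun k => g (Finsupp.single (s k) 1)) fun k k' hkk => ?_
    rw [← hs k, ← hs k', hinj (hsS k) (hsS k') hkk]
  -- Fresh copies, labelled `k`, of the elements of `Q` missed by the span of `S`. With them `θ`
  -- maps the span of `S ∪ T` onto `Q`, and the new pair is a copy of `Q` itself.
  let T : Set (Set Q × Q) := {x | x.1 = k ∧ x.2 ∉ (Finsupp.supported R R S).map g}
  have hTS {x} (hx : x ∈ T) : x ∉ S := fun h => hk x h hx.1
  let θ : (Set Q × Q →₀ R) →ₗ[R] Q :=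
    Finsupp.linearCombination R fun x => if x ∈ S then g (Finsupp.single x 1) else x.2
  have hθ (x) : θ (Finsupp.single x 1) = if x ∈ S then g (Finsupp.single x 1) else x.2 := by
    simp [θ]
  have hθS (x) (hx : x ∈ Finsupp.supported R R S) : θ x = g x := by
    rw [Finsupp.supported_eq_span_single] at hx
    refine LinearMap.eqOn_span (f := θ) (g := g) ?_ hx
    rintro _ ⟨s, hs, rfl⟩
    rw [hθ, if_pos hs]
  have hqθ : q ∘ₗ θ = φ := by
    refine Finsupp.lhom_ext' fun x => LinearMap.ext_ring ?_
    change q (θ (Finsupp.single x 1)) = φ (Finsupp.single x 1)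
    rw [hθ]
    split_ifs
    · rw [← hg]; rfl
    · exact (hφ x).symm
  have hqθ' (x) : q (θ x) = φ x := DFunLike.congr_fun hqθ x
  let F' := Finsupp.supported R R (S ∪ T)
  have hSF : Finsupp.supported R R S ≤ F' := Finsupp.supported_mono Set.subset_union_left
  have hθs : Function.Surjective (θ ∘ₗ F'.subtype) := fun y => by
    by_cases hy : y ∈ (Finsupp.supported R R S).map g
    · obtain ⟨x, hx, rfl⟩ := hy
      exact ⟨⟨x, hSF hx⟩, hθS x hx⟩
    · have hT : (k, y) ∈ T := ⟨rfl, hy⟩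
      exact ⟨⟨_, hsingle (Or.inr hT)⟩, (hθ _).trans (if_neg (hTS hT))⟩
  refine ⟨S ∪ T, LinearMap.ker θ ⊓ F', ⟨inf_le_right, ?_, ?_, ?_, ?_⟩, ?_, ?_⟩
  · exact inf_le_left.trans (hqθ ▸ LinearMap.ker_le_ker_comp θ q)
  · let π : (Set Q × Q →₀ R) →ₗ[R] (Set Q × Q →₀ R) :=
      F'.subtype ∘ₗ Finsupp.restrictDom R R (S ∪ T)
    have hπ (x) : π x ∈ F' := (Finsupp.restrictDom R R (S ∪ T) x).2
    have hπ' (x) (hx : x ∈ F') : π x = x := congrArg Subtype.val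
      (LinearMap.congr_fun (Finsupp.restrictDom_comp_subtype (M := R) (R := R) (S ∪ T)) ⟨x, hx⟩)
    -- `π` projects onto the span of `S ∪ T`, and the pair `(θπ, 1 - π)` embeds the quotient into a
    -- projective module.
    refine hsub.projective_quotient ((θ ∘ₗ π).prod (LinearMap.id - π)) (Submodule.ext fun x => ?_)
    rw [LinearMap.ker_prod, Submodule.mem_inf, Submodule.mem_inf, LinearMap.mem_ker,
      LinearMap.mem_ker, LinearMap.mem_ker, LinearMap.sub_apply, LinearMap.id_apply, sub_eq_zero,
      LinearMap.comp_apply]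
    constructor
    · rintro ⟨h1, h2⟩
      exact ⟨by rwa [← h2] at h1, h2 ▸ hπ x⟩
    · rintro ⟨h1, h2⟩
      rw [hπ' x h2]
      exact ⟨h1, rfl⟩
  · rintro s hs t ht ⟨hst, -⟩
    replace hst := LinearMap.mem_ker.1 hst
    rw [map_sub, sub_eq_zero, hθ, hθ] at hst
    rcases hs with hs | hs <;> rcases ht with ht | ht
    · rw [if_pos hs, if_pos ht] at hst
      exact hinj hs ht hst
    · rw [if_pos hs, if_neg (hTS ht)] at hst
      exact absurd ⟨_, hsingle hs, hst⟩ ht.2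
    · rw [if_neg (hTS hs), if_pos ht] at hst
      exact absurd ⟨_, hsingle ht, hst.symm⟩ hs.2
    · rw [if_neg (hTS hs), if_neg (hTS ht)] at hst
      exact Prod.ext (hs.1.trans ht.1.symm) hst
  · rintro P _ _ _ h hLh hhφ x ⟨hx, hxF⟩
    -- A section of `θ` transports tightness of `q` to the new pair.
    obtain ⟨σ, hσ⟩ := Module.projective_lifting_property _ LinearMap.id hθs
    have hσ (y) : θ (σ y) = y := DFunLike.congr_fun hσ y
    have hinj' := hq.2 P (h ∘ₗ F'.subtype ∘ₗ σ) fun y hy => by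
      have : φ (σ y) = 0 := hhφ ⟨hy, (σ y).2⟩
      rwa [← hqθ', hσ] at this
    have hmem : h (σ (θ x) - x) = 0 :=
      hLh ⟨LinearMap.mem_ker.2 (by rw [map_sub, hσ, sub_self]), sub_mem (σ (θ x)).2 hxF⟩
    rw [map_sub, LinearMap.mem_ker.1 hx, sub_zero] at hmem
    exact ⟨hinj' (a₁ := θ x) (a₂ := 0) (by rw [map_zero]; exact hmem), hxF⟩
  · have hT : (k, y₀) ∈ T := ⟨rfl, hy₀⟩
    exact ⟨Set.subset_union_left, fun h => hTS hT (h (Or.inr hT))⟩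
  · exact fun x hx => ⟨(hθS x (hSL.le_supported hx)).trans (hLg hx), hSF (hSL.le_supported hx)⟩

/-- Endomorphisms of a tight surjection are surjective. -/
theorem IsTight.surjective_of_comp_eq (hsub : SubmodulesProjective R)
    (hunion : UnionsProjective R) {q : Q →ₗ[R] M} (hq : IsTight q) (hs : Function.Surjective q)
    (f : Q →ₗ[R] Q) (hf : q ∘ₗ f = q) : Function.Surjective f := by
  let φ : (Set Q × Q →₀ R) →ₗ[R] M := Finsupp.linearCombination R fun x => q x.2
  have hφ (x) : φ (Finsupp.single x 1) = q x.2 := by simp [φ]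
  obtain ⟨⟨S, L⟩, -, hSL, hmax⟩ := zorn_le_nonempty₀
    {a : Set (Set Q × Q) × Submodule R (Set Q × Q →₀ R) | IsTightPair φ a.1 a.2}
    (fun c hc hchain a ha => ⟨⟨_, _⟩, isTightPair_sSup hunion ⟨a, ha⟩ hchain hc, fun b hb =>
      ⟨Set.subset_biUnion_of_mem (u := Prod.fst) hb, le_sSup ⟨b, hb, rfl⟩⟩⟩)
    (∅, ⊥) (isTightPair_empty hsub φ)
  have := hSL.projective
  -- Both `g` and `f ∘ₗ g` are maps over `M`. If `f` missed `y`, so would `f ∘ₗ g`, and the maximal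
  -- pair could be enlarged along it.
  obtain ⟨g, hg⟩ := Module.projective_lifting_property q (L.liftQ φ hSL.le_ker) hs
  by_contra hfs
  obtain ⟨y, hy⟩ := not_forall.1 hfs
  obtain ⟨S', L', h', hS, hL⟩ := IsTightPair.exists_lt hsub hq hφ hSL (f ∘ₗ g ∘ₗ L.mkQ)
    (by rw [← LinearMap.comp_assoc, hf, ← LinearMap.comp_assoc, hg, L.liftQ_mkQ])
    (fun x hx => by
      have : L.mkQ x = 0 := (Submodule.Quotient.mk_eq_zero L).2 hx
      rw [LinearMap.mem_ker, LinearMap.comp_apply, LinearMap.comp_apply, this, map_zero, map_zero])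
    (y₀ := y) (fun ⟨x, _, hx⟩ => hy ⟨_, hx⟩)
  exact hS.2 (hmax (y := (S', L')) h' ⟨hS.1, hL⟩).1

/-- If `N + ker q = Q`, then `q` restricted to `N` is onto and `q` lifts through it. This gives an
endomorphism of `Q` over `M` with image in `N`; it is surjective, so `N = Q`. -/
theorem isLeftPerfect_of_projective (hsub : SubmodulesProjective R)
    (hunion : UnionsProjective R) : IsLeftPerfect R := by
  intro M _ _
  obtain ⟨Q, q, hq, hs⟩ := exists_isTight_surjective hsub hunion M
  have := hq.1
  refine ⟨Q, q, hq.1, hs, fun N hN => ?_⟩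
  have hqN : Function.Surjective (q ∘ₗ N.subtype) := fun m => by
    obtain ⟨x, rfl⟩ := hs m
    obtain ⟨n, hn, k, hk, rfl⟩ := Submodule.mem_sup.1 
      (hN ▸ Submodule.mem_top : x ∈ N ⊔ LinearMap.ker q)
    exact ⟨⟨n, hn⟩, by rw [map_add, LinearMap.mem_ker.1 hk, add_zero]; rfl⟩
  obtain ⟨g, hg⟩ := Module.projective_lifting_property (q ∘ₗ N.subtype) q hqN
  have hfs := hq.surjective_of_comp_eq hsub hunion hs (N.subtype ∘ₗ g)
    (by rw [← LinearMap.comp_assoc, hg])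
  refine eq_top_iff.2 fun x _ => ?_
  obtain ⟨y, rfl⟩ := hfs x
  exact (g y).2

end ProjectiveCovers

end RingHomological

end

/-! ### The equivalence -/

theorem corollary5p8 (R : Type u) [Ring R] :
    List.TFAE
      [∀ (M : Type u) [AddCommGroup M] [Module R M],
          RingHomological.IsF1Flat R M → Module.Projective R M,
        RingHomological.IsLeftPerfect R ∧ RingHomological.IsLeftHereditary R,
        RingHomological.IsLeftPerfect R ∧ RingHomological.wdim R ≤ 1] := by
  open RingHomological in
  tfae_have 1 → 2 := fun h => by
    have hsub : SubmodulesProjective R := fun N P _ _ _ _ _ i hi => h N (isF1Flat_of_injective hi)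
    have hF1 (P : Type u) [AddCommGroup P] [Module R P] [Module.Projective R P] : IsF1Flat R P :=
      isF1Flat_of_injective (i := LinearMap.id) Function.injective_id
    exact ⟨isLeftPerfect_of_projective hsub fun P _ _ _ c hne hc hproj =>
        h _ (isF1Flat_quotient_sSup hne hc fun L hL => by
          have := hproj L hL
          exact hF1 (P ⧸ L)),
      fun I => hsub I R I.subtype I.injective_subtype⟩
  tfae_have 2 → 3 := fun h => ⟨h.1, h.2.wdim_le_one⟩
  tfae_have 3 → 1 := fun h M _ _ hM => projective_of_isF1Flat h.1 h.2 hM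
  tfae_finish
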